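/- Let four bodies with masses $m_1,m_2,m_3,m_4>0$ have positions $q_1,\dots,q_4$ in a Euclidean space $\mathbb{R}^d$ (in particular $d=2$ or $d=3$), and let $r_{ij}=\|q_i-q_j\|$. The configuration is a (Newtonian) central configuration if the points are distinct and there is a real $\lambda$ with $$\lambda\, m_i\,(q_i-q_{CM})=\sum_{j\ne i}\frac{m_i m_j\,(q_j-q_i)}{r_{ij}^3}\quad (1\le i\le 4),\qquad q_{CM}=\frac{\sum_i m_i q_i}{\sum_i m_i}.$$ It is a standard convex planar configuration if the four points lie in a plane, no two coincide, no three are collinear, none lies in the convex hull of the other three, and they are numbered consecutively along the boundary of their convex quadrilateral, so that $r_{12},r_{23},r_{34},r_{14}$ are the lengths of its sides and $r_{13},r_{24}$ those of its diagonals. **Proposition.** Suppose that we have a standard convex planar central configuration with $m_1=m_2$ and $m_3=m_4$. Then $$r_{13}=r_{24}\quad\text{if and only if}\quad r_{14}=r_{23}.$$ In this case the configuration is an isosceles trapezoid with bodies $1$ and $2$ on one base and bodies $3$ and $4$ on the other. (An isosceles trapezoid is a convex quadrilateral with two parallel sides, the bases, whose other two sides have equal length and whose angles at a base are equal; rectangles,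 in particular squares, are included.) -/

import Mathlib

/-- The centre of mass of bodies with masses `m i` at the positions `q i`. -/
noncomputable def centerOfMass {n d : ℕ} (m : Fin n → ℝ)
    (q : Fin n → EuclideanSpace ℝ (Fin d)) : EuclideanSpace ℝ (Fin d) :=
  (∑ i, m i)⁻¹ • ∑ i, m i • q i

/-- The positions `q i` form a Newtonian central configuration for the masses `m i`:
no two bodies coincide, and for some real `lam` every body satisfies
`lam m_i (q_i - q_CM) = ∑_{j ≠ i} m_i m_j (q_j - q_i) / r_{ij}^3`. -/
def IsCentralConfiguration {n d : ℕ} (m : Fin n → ℝ)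
    (q : Fin n → EuclideanSpace ℝ (Fin d)) : Prop :=
  Function.Injective q ∧
    ∃ lam : ℝ, ∀ i, (lam * m i) • (q i - centerOfMass m q) =
      ∑ j ∈ Finset.univ.erase i, (m i * m j / dist (q i) (q j) ^ 3) • (q j - q i)

/-- No two points coincide and no three of them lie on a line. -/
def IsNondegenerate {n d : ℕ} (q : Fin n → EuclideanSpace ℝ (Fin d)) : Prop :=
  Function.Injective q ∧
    ∀ i j k, i ≠ j → i ≠ k → j ≠ k → ¬ Collinear ℝ {q i, q j, q k}

/-- No point lies in the convex hull of the others. -/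
def IsConvexConfiguration {n d : ℕ} (q : Fin n → EuclideanSpace ℝ (Fin d)) : Prop :=
  ∀ i, q i ∉ convexHull ℝ (q '' {i}ᶜ)

/-- The points are numbered consecutively along the boundary of the quadrilateral: each of the
segments from `q i` to `q (i + 1)` (indices modulo `4`) is an exterior side, that is, the other
two points lie strictly on the same side of the line through it. The remaining two segments,
from `q 0` to `q 2` and from `q 1` to `q 3`, are then the diagonals. -/
def IsOrderedSequentially {d : ℕ} (q : Fin 4 → EuclideanSpace ℝ (Fin d)) : Prop :=
  ∀ i : Fin 4, (affineSpan ℝ {q i, q (i + 1)}).SSameSide (q (i + 2)) (q (i + 3))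

/-- A standard convex planar configuration of four points. -/
structure IsStandardConvex {d : ℕ} (q : Fin 4 → EuclideanSpace ℝ (Fin d)) : Prop where
  planar : Coplanar ℝ (Set.range q)
  nondegenerate : IsNondegenerate q
  convex : IsConvexConfiguration q
  ordered : IsOrderedSequentially q

/-- The convex quadrilateral with consecutive vertices `q 0, q 1, q 2, q 3` is an isosceles
trapezoid with bases `q 0 q 1` and `q 2 q 3`: the bases are parallel, the legs have equal
length, and the two angles at the base `q 0 q 1` are equal. Rectangles are included;
other parallelograms are not. -/
structure IsIsoscelesTrapezoid {d : ℕ} (q : Fin 4 → EuclideanSpace ℝ (Fin d)) : Prop where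
  standard : IsStandardConvex q
  bases_parallel : (affineSpan ℝ {q 0, q 1}).Parallel (affineSpan ℝ {q 2, q 3})
  legs_eq : dist (q 0) (q 3) = dist (q 1) (q 2)
  base_angles_eq :
    EuclideanGeometry.angle (q 3) (q 0) (q 1) = EuclideanGeometry.angle (q 0) (q 1) (q 2)

/-!
Four points in a plane carry, up to scaling, a single affine dependence `w`, and for a convex
quadrilateral with consecutively numbered vertices its signs alternate. Writing the equations of
motion relative to body `i` shows that the off-diagonal entries `m_i m_j (r_{ij}⁻³ - c)`, with the
diagonal chosen to make the row sums vanish, form a symmetric matrix whose rows are affine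
dependences; such a matrix is `κ w wᵀ` (Dziobek). Mixed signs of the products `w_i w_j` give
`c > 0`, and then `∑ w_i w_j r_{ij}² = 0` gives `κ < 0`.

If `m_1 = m_2` and `m_3 = m_4`, equal legs therefore mean `w_1 w_4 = w_2 w_3` and equal diagonals
mean `w_1 w_3 = w_2 w_4`. As `∑ w_i = 0`, these say `(w_1 + w_2) (w_1 + w_3) = 0` and
`(w_1 + w_2) (w_1 + w_4) = 0`, where `w_1 + w_3 > 0`; and `w_1 + w_2 = 0` means that the bases are
parallel. If `w_1 + w_4 = 0`, the other two sides are parallel. Equal diagonals then force all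
masses to be equal, and the two parallel sides solve the same equation `μ c r³ + L r = μ` with
`μ, c, L > 0`, so they have the same length.
-/

section AffineDependences

variable {k V ι : Type*} [Fintype ι] [AddCommGroup V]

/-- The space of coefficient vectors of affine dependences among the points `p i`, that is, of
weights with `∑ i, w i = 0` and `∑ i, w i • p i = 0`. -/
def affineDependences (k : Type*) [Ring k] [Module k V] (p : ι → V) : Submodule k (ι → k) where
  carrier := {w | ∑ i, w i = 0 ∧ ∑ i, w i • p i = 0}
  add_mem' {u w} hu hw := by
    simp only [Set.mem_ofPred_eq] at hu hw ⊢
    simp [add_smul, Finset.sum_add_distrib, hu, hw]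
  zero_mem' := by simp
  smul_mem' c w hw := by
    simp only [Set.mem_ofPred_eq] at hw ⊢
    simp [mul_smul, ← Finset.mul_sum, ← Finset.smul_sum, hw]

theorem mem_affineDependences [Ring k] [Module k V] {p : ι → V} {w : ι → k} :
    w ∈ affineDependences k p ↔ ∑ i, w i = 0 ∧ ∑ i, w i • p i = 0 :=
  Iff.rfl

theorem sub_single_mem_affineDependences [Ring k] [Module k V] [DecidableEq ι] {p : ι → V} {i : ι}
    {a : ι → k} (ha : ∑ j, a j • (p j - p i) = 0) :
    a - Pi.single i (∑ j, a j) ∈ affineDependences k p := by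
  rw [mem_affineDependences]
  constructor
  · simp
  · rw [← ha]
    simp [sub_smul, smul_sub, Finset.sum_smul, Pi.single_apply, ite_smul]

theorem eq_zero_of_mem_affineDependences [Ring k] [Module k V] {n : ℕ} {p : Fin (n + 1) → V}
    {l : Fin (n + 1)} (hp : AffineIndependent k (p ∘ l.succAbove)) {w : Fin (n + 1) → k}
    (hw : w ∈ affineDependences k p) (hl : w l = 0) : w = 0 := by
  obtain ⟨hsum, hcomb⟩ := mem_affineDependences.1 hw
  rw [Fin.sum_univ_succAbove _ l, hl] at hsum hcomb
  have hoff := hp.eq_zero_of_sum_eq_zero (s := Finset.univ) (w := w ∘ l.succAbove)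
    (by simpa using hsum) (by simpa using hcomb)
  exact funext <| (Fin.forall_iff_succAbove l).2 ⟨hl, fun i => hoff i (Finset.mem_univ i)⟩

theorem affineDependences_le_span_singleton [Field k] [Module k V] {n : ℕ} {p : Fin (n + 1) → V}
    {l : Fin (n + 1)} (hp : AffineIndependent k (p ∘ l.succAbove)) {w : Fin (n + 1) → k}
    (hw : w ∈ affineDependences k p) (hl : w l ≠ 0) :
    affineDependences k p ≤ Submodule.span k {w} := by
  intro u hu
  have hmem : u - (u l / w l) • w ∈ affineDependences k p :=
    Submodule.sub_mem _ hu (Submodule.smul_mem _ _ hw)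
  have hzero := eq_zero_of_mem_affineDependences hp hmem (by simp [hl])
  exact Submodule.mem_span_singleton.2 ⟨u l / w l, (sub_eq_zero.1 hzero).symm⟩

theorem exists_mem_affineDependences_of_sSameSide [Field k] [LinearOrder k]
    [IsStrictOrderedRing k] [Module k V] {p : ι → V} {a b c e : ι} (hca : c ≠ a) (hcb : c ≠ b)
    (hea : e ≠ a) (heb : e ≠ b) (hce : c ≠ e)
    (h : (affineSpan k {p a, p b}).SSameSide (p c) (p e)) :
    ∃ w ∈ affineDependences k p, 0 < w c ∧ w e < 0 := by
  classical
  obtain ⟨hc, he, x, hx, hray⟩ :=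
    (AffineSubspace.sSameSide_iff_exists_left (left_mem_affineSpan_pair k (p a) (p b))).1 h
  obtain ⟨t, rfl⟩ := mem_affineSpan_pair_iff_exists_lineMap_eq.1 hx
  have hca0 : p c -ᵥ p a ≠ 0 :=
    vsub_ne_zero.2 fun h0 => hc (h0 ▸ left_mem_affineSpan_pair k (p a) (p b))
  have hex0 : p e -ᵥ AffineMap.lineMap (p a) (p b) t ≠ 0 := vsub_ne_zero.2 fun h0 => he (h0 ▸ hx)
  obtain ⟨r, s, hr, hs, hrs⟩ := hray.exists_pos hca0 hex0
  refine ⟨Pi.single c r - Pi.single e s + Pi.single a (s * (1 - t) - r) + Pi.single b (s * t),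
    mem_affineDependences.2 ⟨?_, ?_⟩, ?_, ?_⟩
  · simp only [Pi.add_apply, Pi.sub_apply, Finset.sum_add_distrib, Finset.sum_sub_distrib,
      Finset.sum_pi_single', Finset.mem_univ, if_true]
    ring
  · simp only [AffineMap.lineMap_apply_module, vsub_eq_sub] at hrs
    simp only [Pi.add_apply, Pi.sub_apply, add_smul, sub_smul, Finset.sum_add_distrib,
      Finset.sum_sub_distrib, Pi.single_apply, ite_smul, zero_smul, Finset.sum_ite_eq',
      Finset.mem_univ, if_true]
    rw [← sub_eq_zero] at hrs
    rw [← hrs]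
    module
  · simpa [hca, hcb, hce] using hr
  · simpa [hea, heb, hce.symm] using hs

end AffineDependences

theorem exists_forall_apply_eq_mul_of_isSymm {k ι : Type*} [Field k] {A : Matrix ι ι k}
    (hA : A.IsSymm) {w : ι → k} (hw : w ≠ 0) (hrow : ∀ i, A i ∈ Submodule.span k {w}) :
    ∃ κ, ∀ i j, A i j = κ * (w i * w j) := by
  simp only [Submodule.mem_span_singleton] at hrow
  choose a ha using hrow
  have hentry : ∀ i j, A i j = a i * w j := fun i j => by simp [← ha]
  obtain ⟨l, hl⟩ := Function.ne_iff.1 hw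
  refine ⟨a l / w l, fun i j => ?_⟩
  have hsymm : a i * w l = a l * w i := by rw [← hentry, ← hentry, hA.apply]
  rw [hentry, eq_div_of_mul_eq hl hsymm]
  ring

theorem sum_mul_mul_dist_sq_eq_zero {ι E : Type*} [Fintype ι] [NormedAddCommGroup E]
    [InnerProductSpace ℝ E] {p : ι → E} {w : ι → ℝ} (hw : w ∈ affineDependences ℝ p) :
    ∑ i, ∑ j, w i * w j * dist (p i) (p j) ^ 2 = 0 := by
  obtain ⟨hsum, hcomb⟩ := mem_affineDependences.1 hw
  have h := inner_sum_smul_sum_smul_of_sum_eq_zero p hsum p hsum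
  simp only [hcomb, inner_zero_left, ← dist_eq_norm, ← pow_two] at h
  linarith

section Dziobek

variable {ι E : Type*} {m w : ι → ℝ} {p : ι → E} {c κ : ℝ}

/-- Dziobek's relations: `r_{ij}⁻³ - c` is proportional to `w_i w_j / (m_i m_j)`. For four bodies in
a plane the `w i` are the coefficients of an affine dependence among the positions. -/
def DziobekRelations [Dist E] (m : ι → ℝ) (p : ι → E) (w : ι → ℝ) (c κ : ℝ) : Prop :=
  ∀ i j, i ≠ j → m i * m j * (1 / dist (p i) (p j) ^ 3 - c) = κ * (w i * w j)

namespace DziobekRelations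

theorem dist_eq_dist_iff [PseudoMetricSpace E] (h : DziobekRelations m p w c κ) (hκ : κ ≠ 0)
    {i j k l : ι} (hij : i ≠ j) (hkl : k ≠ l) (hm0 : m i * m j ≠ 0)
    (hm : m i * m j = m k * m l) :
    dist (p i) (p j) = dist (p k) (p l) ↔ w i * w j = w k * w l := by
  rw [← mul_right_inj' hκ (b := w i * w j), ← h i j hij, ← h k l hkl, ← hm, mul_right_inj' hm0,
    sub_left_inj, one_div, one_div, inv_inj, pow_left_inj₀ dist_nonneg dist_nonneg three_ne_zero]

theorem mass_mul_eq_mass_mul [Dist E] (h : DziobekRelations m p w c κ) (hκ : κ ≠ 0)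
    {i j k l : ι} (hij : i ≠ j) (hkl : k ≠ l) (hw0 : w i * w j ≠ 0) (hw : w i * w j = w k * w l)
    (hd : dist (p i) (p j) = dist (p k) (p l)) : m i * m j = m k * m l := by
  have hne := mul_ne_zero hκ hw0
  rw [← h i j hij] at hne
  refine mul_right_cancel₀ (right_ne_zero_of_mul hne) ?_
  rw [h i j hij, hd, h k l hkl, hw]

theorem const_pos [MetricSpace E] (h : DziobekRelations m p w c κ) (hm : ∀ i, 0 < m i)
    (hp : Function.Injective p) {i j k : ι} (hij : i ≠ j) (hik : i ≠ k) (hneg : w i * w j ≤ 0)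
    (hpos : 0 ≤ w i * w k) : 0 < c := by
  have of_nonpos : ∀ l, i ≠ l → κ * (w i * w l) ≤ 0 → 0 < c := by
    intro l hil hle
    rw [← h i l hil] at hle
    have hinv : 0 < 1 / dist (p i) (p l) ^ 3 := by
      have := dist_pos.2 (hp.ne hil)
      positivity
    linarith [nonpos_of_mul_nonpos_right hle (mul_pos (hm i) (hm l))]
  rcases le_total 0 κ with hκ | hκ
  · exact of_nonpos j hij (mul_nonpos_of_nonneg_of_nonpos hκ hneg)
  · exact of_nonpos k hik (mul_nonpos_of_nonpos_of_nonneg hκ hpos)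

theorem mul_mul_dist_sq_sub_sq_nonpos [MetricSpace E] {ρ : ℝ}
    (h : DziobekRelations m p w (1 / ρ ^ 3) κ) (hm : ∀ i, 0 < m i) (hp : Function.Injective p)
    (hρ : 0 < ρ) (hκ : 0 ≤ κ) (i j : ι) : w i * w j * (dist (p i) (p j) ^ 2 - ρ ^ 2) ≤ 0 := by
  rcases eq_or_ne i j with rfl | hij
  · rw [dist_self]
    nlinarith [mul_nonneg (mul_self_nonneg (w i)) (sq_nonneg ρ)]
  have hr := dist_pos.2 (hp.ne hij)
  have hmm := mul_pos (hm i) (hm j)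
  rcases lt_trichotomy (dist (p i) (p j)) ρ with hlt | heq | hgt
  · have hinv : 1 / ρ ^ 3 < 1 / dist (p i) (p j) ^ 3 := by gcongr
    have hww : 0 < w i * w j :=
      pos_of_mul_pos_right (h i j hij ▸ mul_pos hmm (sub_pos.2 hinv)) hκ
    exact mul_nonpos_of_nonneg_of_nonpos hww.le (sub_nonpos.2 (by gcongr))
  · simp [heq]
  · have hinv : 1 / dist (p i) (p j) ^ 3 < 1 / ρ ^ 3 := by gcongr
    have hww : w i * w j < 0 :=
      neg_of_mul_neg_right (h i j hij ▸ mul_neg_of_pos_of_neg hmm (sub_neg.2 hinv)) hκ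
    exact mul_nonpos_of_nonpos_of_nonneg hww.le (sub_nonneg.2 (by gcongr))

theorem multiplier_neg [Fintype ι] [NormedAddCommGroup E] [InnerProductSpace ℝ E]
    (h : DziobekRelations m p w c κ) (hm : ∀ i, 0 < m i) (hp : Function.Injective p)
    (hc : 0 < c) (hw : w ∈ affineDependences ℝ p) (hw0 : w ≠ 0) : κ < 0 := by
  by_contra! hκ
  obtain ⟨ρ, hρ, rfl⟩ : ∃ ρ : ℝ, 0 < ρ ∧ 1 / ρ ^ 3 = c :=
    ⟨c⁻¹ ^ (3⁻¹ : ℝ), by positivity, by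
      rw [← Nat.cast_ofNat, Real.rpow_inv_natCast_pow (by positivity) three_ne_zero, one_div,
        inv_inv]⟩
  -- Since `∑ i, w i = 0`, subtracting `ρ ^ 2` from every squared distance does not change their
  -- weighted sum, but for `κ ≥ 0` it leaves only nonpositive terms.
  have term_nonpos := h.mul_mul_dist_sq_sub_sq_nonpos hm hp hρ hκ
  have sum_eq_zero : ∑ i, ∑ j, w i * w j * (dist (p i) (p j) ^ 2 - ρ ^ 2) = 0 := by
    simp only [mul_sub, Finset.sum_sub_distrib, sum_mul_mul_dist_sq_eq_zero hw, ← Finset.sum_mul,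
      ← Finset.mul_sum, (mem_affineDependences.1 hw).1, mul_zero, zero_mul, sub_zero]
  obtain ⟨l, hl⟩ := Function.ne_iff.1 hw0
  have row_eq_zero := (Finset.sum_eq_zero_iff_of_nonpos fun i _ =>
    Finset.sum_nonpos fun j _ => term_nonpos i j).1 sum_eq_zero l (Finset.mem_univ l)
  have term_eq_zero := (Finset.sum_eq_zero_iff_of_nonpos fun j _ => term_nonpos l j).1
    row_eq_zero l (Finset.mem_univ l)
  rw [dist_self] at term_eq_zero
  have : w l * w l * (0 ^ 2 - ρ ^ 2) ≠ 0 := by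
    simpa [hρ.ne'] using hl
  contradiction

end DziobekRelations

end Dziobek

theorem IsCentralConfiguration.exists_sum_smul_sub_eq_zero {n d : ℕ} {m : Fin n → ℝ}
    {q : Fin n → EuclideanSpace ℝ (Fin d)} (hcc : IsCentralConfiguration m q)
    (hM : ∑ i, m i ≠ 0) :
    ∃ c : ℝ, ∀ i, ∑ j, (m i * m j * (1 / dist (q i) (q j) ^ 3 - c)) • (q j - q i) = 0 := by
  obtain ⟨-, lam, hlam⟩ := hcc
  refine ⟨-lam / ∑ i, m i, fun i => ?_⟩
  have hcenter : q i - centerOfMass m q = -((∑ i, m i)⁻¹ • ∑ j, m j • (q j - q i)) := by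
    simp only [centerOfMass, smul_sub, Finset.sum_sub_distrib, ← Finset.sum_smul]
    rw [inv_smul_smul₀ hM]
    abel
  have hforce := hlam i
  rw [Finset.sum_erase _ (by simp), hcenter, eq_comm, ← sub_eq_zero] at hforce
  rw [← hforce]
  simp only [Finset.smul_sum, ← Finset.sum_neg_distrib, ← Finset.sum_sub_distrib]
  refine Finset.sum_congr rfl fun j _ => ?_
  module

theorem IsCentralConfiguration.exists_dziobekRelations {n d : ℕ} {m : Fin n → ℝ}
    {q : Fin n → EuclideanSpace ℝ (Fin d)} (hcc : IsCentralConfiguration m q)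
    (hM : ∑ i, m i ≠ 0) {w : Fin n → ℝ} (hw : w ≠ 0)
    (hdep : affineDependences ℝ q ≤ Submodule.span ℝ {w}) :
    ∃ c κ, DziobekRelations m q w c κ := by
  obtain ⟨c, hc⟩ := hcc.exists_sum_smul_sub_eq_zero hM
  let S : Matrix (Fin n) (Fin n) ℝ :=
    Matrix.of fun i j => m i * m j * (1 / dist (q i) (q j) ^ 3 - c)
  have hS : S.IsSymm := Matrix.IsSymm.ext fun i j => by simp [S, dist_comm, mul_comm]
  have hA : (S - Matrix.diagonal fun i => ∑ j, S i j).IsSymm := hS.sub (Matrix.isSymm_diagonal _)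
  have hrow : ∀ i, (S - Matrix.diagonal fun i => ∑ j, S i j) i ∈ Submodule.span ℝ {w} := by
    intro i
    have := hdep (sub_single_mem_affineDependences (hc i))
    convert this using 1
    ext j
    simp [S, Matrix.diagonal_apply, Pi.single_apply, eq_comm]
  obtain ⟨κ, hκ⟩ := exists_forall_apply_eq_mul_of_isSymm hA hw hrow
  refine ⟨c, κ, fun i j hij => ?_⟩
  simpa [S, hij] using hκ i j

theorem IsNondegenerate.affineIndependent_comp_succAbove {d : ℕ}
    {q : Fin 4 → EuclideanSpace ℝ (Fin d)} (hq : IsNondegenerate q) (l : Fin 4) :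
    AffineIndependent ℝ (q ∘ l.succAbove) := by
  have hinj := l.succAbove_right_injective
  have hcol := hq.2 (l.succAbove 0) (l.succAbove 1) (l.succAbove 2) (hinj.ne (by decide))
    (hinj.ne (by decide)) (hinj.ne (by decide))
  rw [affineIndependent_iff_not_collinear]
  convert hcol
  ext x
  simp [Fin.exists_fin_succ, eq_comm]

theorem IsNondegenerate.affineDependences_le {d : ℕ}
    {q : Fin 4 → EuclideanSpace ℝ (Fin d)} (hq : IsNondegenerate q) {w : Fin 4 → ℝ}
    (hw : w ∈ affineDependences ℝ q) (hw0 : w ≠ 0) :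
    affineDependences ℝ q ≤ Submodule.span ℝ {w} := by
  obtain ⟨l, hl⟩ := Function.ne_iff.1 hw0
  exact affineDependences_le_span_singleton (hq.affineIndependent_comp_succAbove l) hw hl

theorem IsOrderedSequentially.mul_neg_of_mem_affineDependences {d : ℕ}
    {q : Fin 4 → EuclideanSpace ℝ (Fin d)} (hord : IsOrderedSequentially q)
    (hq : IsNondegenerate q) {w : Fin 4 → ℝ} (hw : w ∈ affineDependences ℝ q) (hw0 : w ≠ 0)
    (i : Fin 4) : w (i + 2) * w (i + 3) < 0 := by
  obtain ⟨u, hu, hpos, hneg⟩ := exists_mem_affineDependences_of_sSameSide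
    (by fin_cases i <;> decide) (by fin_cases i <;> decide) (by fin_cases i <;> decide)
    (by fin_cases i <;> decide) (by fin_cases i <;> decide) (hord i)
  obtain ⟨r, rfl⟩ := Submodule.mem_span_singleton.1
    (hq.affineDependences_le hu (fun h => by simp [h] at hpos) hw)
  have hr := left_ne_zero_of_smul hw0
  simp only [Pi.smul_apply, smul_eq_mul]
  calc r * u (i + 2) * (r * u (i + 3)) = r ^ 2 * (u (i + 2) * u (i + 3)) := by ring
    _ < 0 := mul_neg_of_pos_of_neg (by positivity) (mul_neg_of_pos_of_neg hpos hneg)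

theorem IsOrderedSequentially.exists_alternating {d : ℕ}
    {q : Fin 4 → EuclideanSpace ℝ (Fin d)} (hord : IsOrderedSequentially q)
    (hq : IsNondegenerate q) :
    ∃ w ∈ affineDependences ℝ q, 0 < w 0 ∧ w 1 < 0 ∧ 0 < w 2 ∧ w 3 < 0 := by
  obtain ⟨w, hw, hw₂, hw₃⟩ := exists_mem_affineDependences_of_sSameSide
    (by decide) (by decide) (by decide) (by decide) (by decide) (hord 0)
  have hw0 : w ≠ 0 := fun h => by simp [h] at hw₂
  have hw₀ : 0 < w 0 :=
    pos_of_mul_neg_right (hord.mul_neg_of_mem_affineDependences hq hw hw0 1) hw₃.le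
  have hw₁ : w 1 < 0 :=
    neg_of_mul_neg_right (hord.mul_neg_of_mem_affineDependences hq hw hw0 2) hw₀.le
  exact ⟨w, hw, hw₀, hw₁, hw₂, hw₃⟩

theorem IsStandardConvex.exists_dziobekRelations {d : ℕ} {m : Fin 4 → ℝ}
    {q : Fin 4 → EuclideanSpace ℝ (Fin d)} (hq : IsStandardConvex q) (hm : ∀ i, 0 < m i)
    (hcc : IsCentralConfiguration m q) :
    ∃ w ∈ affineDependences ℝ q, (0 < w 0 ∧ w 1 < 0 ∧ 0 < w 2 ∧ w 3 < 0) ∧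
      ∃ c κ, 0 < c ∧ κ < 0 ∧ DziobekRelations m q w c κ := by
  obtain ⟨w, hw, hw₀, hw₁, hw₂, hw₃⟩ := hq.ordered.exists_alternating hq.nondegenerate
  have hw0 : w ≠ 0 := fun h => by simp [h] at hw₀
  have hinj := hq.nondegenerate.1
  have hM : 0 < ∑ i, m i := Finset.sum_pos (fun i _ => hm i) Finset.univ_nonempty
  obtain ⟨c, κ, hD⟩ :=
    hcc.exists_dziobekRelations hM.ne' hw0 (hq.nondegenerate.affineDependences_le hw hw0)
  have hc : 0 < c := hD.const_pos hm hinj (i := 0) (j := 1) (k := 2) (by decide) (by decide)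
    (mul_neg_of_pos_of_neg hw₀ hw₁).le (mul_pos hw₀ hw₂).le
  exact ⟨w, hw, ⟨hw₀, hw₁, hw₂, hw₃⟩, c, κ, hc, hD.multiplier_neg hm hinj hc hw hw0, hD⟩

theorem dist_eq_dist_of_smul_sub_eq_smul_sub {E : Type*} [NormedAddCommGroup E]
    [InnerProductSpace ℝ E] {x₀ x₁ x₂ x₃ : E} {a b : ℝ} (hab : a + b ≠ 0)
    (hpar : a • (x₀ - x₃) = b • (x₁ - x₂)) (hdiag : dist x₀ x₂ = dist x₁ x₃) :
    dist x₀ x₁ = dist x₂ x₃ := by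
  rw [dist_comm x₁, dist_eq_norm, dist_eq_norm, ← real_inner_add_sub_eq_zero_iff] at hdiag
  rw [dist_comm x₂, dist_eq_norm, dist_eq_norm, ← real_inner_add_sub_eq_zero_iff]
  have hsub : (a + b) • (x₀ - x₁ - (x₃ - x₂)) = (b - a) • (x₀ - x₂ - (x₃ - x₁)) := by
    have hdiff : (a + b) • (x₀ - x₁ - (x₃ - x₂)) - (b - a) • (x₀ - x₂ - (x₃ - x₁)) =
        (2 : ℝ) • (a • (x₀ - x₃) - b • (x₁ - x₂)) := by module
    rw [← sub_eq_zero, hdiff, hpar, sub_self, smul_zero]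
  have hadd : x₀ - x₁ + (x₃ - x₂) = x₀ - x₂ + (x₃ - x₁) := by abel
  refine (mul_eq_zero.1 ?_).resolve_left hab
  rw [← real_inner_smul_right, hsub, hadd, real_inner_smul_right, hdiag, mul_zero]

theorem eq_of_mul_one_div_cube_sub_eq {a b x y c μ K : ℝ} (ha : a ≠ 0) (hb : b ≠ 0)
    (hμ : 0 < μ) (hc : 0 < c) (hK : 0 < K) (hab : a * x = b * y)
    (hx : μ * (1 / a ^ 3 - c) = K * x ^ 2) (hy : μ * (1 / b ^ 3 - c) = K * y ^ 2) : a = b := by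
  have hmono : StrictMono fun r : ℝ => μ * c * r ^ 3 + K * (a * x) ^ 2 * r :=
    ((Odd.strictMono_pow (by decide)).const_mul (mul_pos hμ hc)).add_monotone
      (monotone_id.const_mul (by positivity))
  have value_eq : ∀ {r z : ℝ}, r ≠ 0 → r * z = a * x → μ * (1 / r ^ 3 - c) = K * z ^ 2 →
      μ * c * r ^ 3 + K * (a * x) ^ 2 * r = μ := by
    intro r z hr hrz h
    field_simp at h
    rw [← hrz]
    linear_combination -h
  exact hmono.injective ((value_eq ha rfl hx).trans (value_eq hb hab.symm hy).symm)

theorem mul_eq_mul_iff_of_sum_eq_zero {R : Type*} [CommRing R] [NoZeroDivisors R] {x y z t : R}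
    (hsum : x + y + z + t = 0) : x * t = y * z ↔ x + y = 0 ∨ x + z = 0 := by
  have hfac : (x + y) * (x + z) = -(x * t - y * z) := by linear_combination x * hsum
  rw [← mul_eq_zero, hfac, neg_eq_zero, sub_eq_zero]

theorem DziobekRelations.dist_eq_dist_of_add_eq_zero {E : Type*} [NormedAddCommGroup E]
    [InnerProductSpace ℝ E] {m w : Fin 4 → ℝ} {q : Fin 4 → E} {c κ : ℝ}
    (h : DziobekRelations m q w c κ) (hm : ∀ i, 0 < m i) (hq : Function.Injective q)
    (hc : 0 < c) (hκ : κ < 0) (hw : w ∈ affineDependences ℝ q) (hw₀ : 0 < w 0) (hw₂ : 0 < w 2)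
    (hw₀₃ : w 0 + w 3 = 0) (hm₀₁ : m 0 = m 1) (hm₂₃ : m 2 = m 3)
    (hdiag : dist (q 0) (q 2) = dist (q 1) (q 3)) : dist (q 0) (q 3) = dist (q 1) (q 2) := by
  obtain ⟨hsum, hcomb⟩ := mem_affineDependences.1 hw
  rw [Fin.sum_univ_four] at hsum hcomb
  have hw₃ : w 3 = -w 0 := by linarith
  have hw₁ : w 1 = -w 2 := by linarith
  have hpar : w 0 • (q 0 - q 3) = w 2 • (q 1 - q 2) := by
    rw [← sub_eq_zero, ← hcomb, hw₁, hw₃]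
    module
  have hsides : dist (q 0) (q 1) = dist (q 2) (q 3) :=
    dist_eq_dist_of_smul_sub_eq_smul_sub (by positivity) hpar hdiag
  have hbases : dist (q 0) (q 3) * w 0 = dist (q 1) (q 2) * w 2 := by
    have hnorm := congrArg norm hpar
    rw [norm_smul_of_nonneg hw₀.le, norm_smul_of_nonneg hw₂.le] at hnorm
    rw [dist_eq_norm, dist_eq_norm, mul_comm, hnorm, mul_comm]
  have hmass : m 0 = m 2 := by
    have hprod : m 0 * m 1 = m 2 * m 3 :=
      h.mass_mul_eq_mass_mul hκ.ne (by decide) (by decide)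
        (mul_ne_zero hw₀.ne' (by rw [hw₁]; exact neg_ne_zero.2 hw₂.ne'))
        (by rw [hw₁, hw₃]; ring) hsides
    rw [← hm₀₁, ← hm₂₃] at hprod
    exact (mul_self_inj (hm 0).le (hm 2).le).1 hprod
  have h₀₃ := h 0 3 (by decide)
  have h₁₂ := h 1 2 (by decide)
  rw [← hm₂₃, ← hmass, hw₃] at h₀₃
  rw [← hm₀₁, ← hmass, hw₁] at h₁₂
  exact eq_of_mul_one_div_cube_sub_eq (dist_ne_zero.2 (hq.ne (by decide)))
    (dist_ne_zero.2 (hq.ne (by decide))) (mul_pos (hm 0) (hm 0)) hc (neg_pos.2 hκ) hbases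
    (by linear_combination h₀₃) (by linear_combination h₁₂)

theorem affineSpan_pair_parallel_of_smul_sub_eq_smul_sub {k V : Type*} [Field k] [AddCommGroup V]
    [Module k V] {x₀ x₁ x₂ x₃ : V} {a b : k} (ha : a ≠ 0) (hb : b ≠ 0)
    (h : a • (x₁ - x₀) = b • (x₃ - x₂)) :
    (affineSpan k {x₀, x₁}).Parallel (affineSpan k {x₂, x₃}) :=
  AffineSubspace.affineSpan_pair_parallel_iff_exists_unit_smul'.2
    ⟨Units.mk0 (b⁻¹ * a) (mul_ne_zero (inv_ne_zero hb) ha), by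
      simp only [Units.smul_mk0, mul_smul, vsub_eq_sub, h, inv_smul_smul₀ hb]⟩

theorem angle_eq_angle_of_dist_eq {E : Type*} [NormedAddCommGroup E] [InnerProductSpace ℝ E]
    {x₀ x₁ x₂ x₃ : E} (hdiag : dist x₀ x₂ = dist x₁ x₃) (hlegs : dist x₀ x₃ = dist x₁ x₂) :
    EuclideanGeometry.angle x₃ x₀ x₁ = EuclideanGeometry.angle x₀ x₁ x₂ := by
  have hcongr := EuclideanGeometry.side_side_side (a := x₃) (b := x₀) (c := x₁) (a' := x₂)
    (b' := x₁) (c' := x₀) (by rw [dist_comm, hlegs, dist_comm]) (dist_comm _ _) hdiag.symm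
  rw [EuclideanGeometry.angle_comm x₀ x₁ x₂]
  exact EuclideanGeometry.angle_eq_of_congruent hcongr 0 1 2

theorem IsStandardConvex.isIsoscelesTrapezoid {d : ℕ} {q : Fin 4 → EuclideanSpace ℝ (Fin d)}
    (hq : IsStandardConvex q) {w : Fin 4 → ℝ} (hw : w ∈ affineDependences ℝ q) (hw₀ : w 0 ≠ 0)
    (hw₂ : w 2 ≠ 0) (hw₀₁ : w 0 + w 1 = 0) (hdiag : dist (q 0) (q 2) = dist (q 1) (q 3))
    (hlegs : dist (q 0) (q 3) = dist (q 1) (q 2)) : IsIsoscelesTrapezoid q where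
  standard := hq
  bases_parallel := by
    obtain ⟨hsum, hcomb⟩ := mem_affineDependences.1 hw
    rw [Fin.sum_univ_four] at hsum hcomb
    have hw₁ : w 1 = -w 0 := by linarith
    have hw₃ : w 3 = -w 2 := by linarith
    refine affineSpan_pair_parallel_of_smul_sub_eq_smul_sub hw₀ (neg_ne_zero.2 hw₂) ?_
    rw [← sub_eq_zero, ← neg_eq_zero, ← hcomb, hw₁, hw₃]
    module
  legs_eq := hlegs
  base_angles_eq := angle_eq_angle_of_dist_eq hdiag hlegs

/-- The bodies `1, 2, 3, 4` have the indices `0, 1, 2, 3`. -/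
theorem mainTheorem4 {d : ℕ} (m : Fin 4 → ℝ) (q : Fin 4 → EuclideanSpace ℝ (Fin d))
    (hm : ∀ i, 0 < m i) (hcc : IsCentralConfiguration m q) (hq : IsStandardConvex q)
    (h12 : m 0 = m 1) (h34 : m 2 = m 3) :
    (dist (q 0) (q 2) = dist (q 1) (q 3) ↔ dist (q 0) (q 3) = dist (q 1) (q 2)) ∧
      ((dist (q 0) (q 2) = dist (q 1) (q 3) ∨ dist (q 0) (q 3) = dist (q 1) (q 2)) →
        IsIsoscelesTrapezoid q) := by
  obtain ⟨w, hw, ⟨hw₀, -, hw₂, -⟩, c, κ, hc, hκ, hD⟩ := hq.exists_dziobekRelations hm hcc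
  have hsum : w 0 + w 1 + w 2 + w 3 = 0 := Fin.sum_univ_four w ▸ (mem_affineDependences.1 hw).1
  have hmm (i j) : m i * m j ≠ 0 := (mul_pos (hm i) (hm j)).ne'
  have legs_iff : dist (q 0) (q 3) = dist (q 1) (q 2) ↔ w 0 + w 1 = 0 := by
    rw [hD.dist_eq_dist_iff hκ.ne (by decide) (by decide) (hmm 0 3) (by rw [h12, h34]),
      mul_eq_mul_iff_of_sum_eq_zero hsum, or_iff_left (add_pos hw₀ hw₂).ne']
  have diag_iff : dist (q 0) (q 2) = dist (q 1) (q 3) ↔ w 0 + w 1 = 0 := by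
    have hiff := hD.dist_eq_dist_iff hκ.ne (i := 0) (j := 2) (k := 1) (l := 3) (by decide)
      (by decide) (hmm 0 2) (by rw [h12, h34])
    rw [mul_eq_mul_iff_of_sum_eq_zero (by linarith)] at hiff
    refine ⟨fun h => (hiff.1 h).elim id fun hw₀₃ => legs_iff.1 ?_, fun h => hiff.2 (.inl h)⟩
    exact hD.dist_eq_dist_of_add_eq_zero hm hq.nondegenerate.1 hc hκ hw hw₀ hw₂ hw₀₃ h12 h34 h
  refine ⟨diag_iff.trans legs_iff.symm, fun h => ?_⟩
  have hw₀₁ : w 0 + w 1 = 0 := h.elim diag_iff.1 legs_iff.1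
  exact hq.isIsoscelesTrapezoid hw hw₀.ne' hw₂.ne' hw₀₁ (diag_iff.2 hw₀₁) (legs_iff.2 hw₀₁)
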